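/- Let $T>0$ and let $p,q,m$ be nonnegative integers. Consider the repetitive linear system on the time interval $[0,T]$ $$Y_k(s)=G_1(s)U_k(s)+G_2(s)D(s),\qquad k=0,1,2,\dots,$$ where $G_1$ and $G_2$ are real rational matrices of sizes $q\times p$ and $q\times m$, $D$ is the Laplace transform of an additional input (disturbance and initial condition), and $U_k,Y_k$ are the Laplace transforms of the input $u_k(t)\in\mathbb{R}^p$ and of the continuous output $y_k(t)\in\mathbb{R}^q$ of the $k$-th iteration. An input $u$ on $[0,T]$ is said to generate an output $y$ on $[0,T]$ if $u$ and $y$ are the restrictions to $[0,T]$ of signals on $[0,\infty)$ with Laplace transforms $U$ and $Y$ (absolutely convergent for large $\operatorname{Re}s$) such that $G_1(s)U(s)=Y(s)-G_2(s)D(s)$ for all $s$ of sufficiently large real part; $u_k$ generates $y_k$ in this sense for every $k$. A trajectory $y_d:[0,T]\to\mathbb{R}^q$ is trackable if some input on $[0,T]$ generates it, and realizable if exactly one input on $[0,T]$ does (inputs that agree almost everywhere on $[0,T]$ being identified). Assume: C1) $G_1$ and $G_2$ are strictly proper, i.e. $G_i(s)\to0$ as $s\to\infty$; C2) $D(s)=d_0+\widehat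 D(s)$ for some nonzero $d_0\in\mathbb{R}^m$ and some strictly proper real rational vector $\widehat D$; C3) $G_1$ has relative degree one, i.e. $sG_1(s)$ converges, as $s\to\infty$, to a real matrix of full rank $\min(q,p)$. Let $y_d$ be continuously differentiable on $[0,T]$ and satisfy the initial condition $y_d(0)=y_k(0)$ for all $k\ge0$. Then: 1) if $q\ge p$, then $y_d$ is realizable if and only if it is trackable; 2) if $q<p$, then $y_d$ is trackable but not realizable. -/

import Mathlib

open Filter Topology MeasureTheory
open scoped Matrix

noncomputable section

/-! ### Signals and the Laplace transform -/

/-- A signal `f : ℝ → ℝⁿ`, considered for times `t ≥ 0`, has a Laplace transform: for some real `σ`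
the function `t ↦ e^{-σ t} f(t)` is absolutely integrable on `(0, ∞)`. -/
def HasLaplaceTransform {n : ℕ} (f : ℝ → Fin n → ℝ) : Prop :=
  ∃ σ : ℝ, IntegrableOn (fun t : ℝ => Real.exp (-σ * t) • f t) (Set.Ioi 0)

/-- The (one-sided, componentwise) Laplace transform `F(s) = ∫₀^∞ e^{-s t} f(t) dt`. It is only ever
used for signals with `HasLaplaceTransform` and for `s` of large real part. -/
def laplaceTransform {n : ℕ} (f : ℝ → Fin n → ℝ) (s : ℂ) : Fin n → ℂ :=
  fun i => ∫ t in Set.Ioi (0 : ℝ), Complex.exp (-s * (t : ℂ)) * ((f t i : ℝ) : ℂ)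

/-! ### Rational fraction matrices -/

/-- The value `G(s)` of a real rational fraction matrix at a complex point `s`. It is only ever used
away from the finitely many poles of the entries. -/
def ratEval {q p : ℕ} (G : Matrix (Fin q) (Fin p) (RatFunc ℝ)) (s : ℂ) :
    Matrix (Fin q) (Fin p) ℂ :=
  G.map (RatFunc.eval (algebraMap ℝ ℂ) s)

/-- `G` is strictly proper: `G(s) → 0` as `s → ∞`. -/
def IsStrictlyProper {q p : ℕ} (G : Matrix (Fin q) (Fin p) (RatFunc ℝ)) : Prop :=
  Tendsto (ratEval G) (Bornology.cobounded ℂ) (𝓝 0)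

/-- `G` has relative degree `r`: `s ^ r G(s)` tends, as `s → ∞`, to a real matrix of full rank
(full row rank if `q ≤ p`, full column rank if `p ≤ q`). That limit is then the leading coefficient
of the expansion of `G` in powers of `s⁻¹`. -/
def HasRelativeDegree {q p : ℕ} (G : Matrix (Fin q) (Fin p) (RatFunc ℝ)) (r : ℕ) : Prop :=
  ∃ M : Matrix (Fin q) (Fin p) ℝ,
    Tendsto (fun s : ℂ => s ^ r • ratEval G s) (Bornology.cobounded ℂ)
      (𝓝 (M.map (fun x : ℝ => (x : ℂ)))) ∧
    M.rank = min q p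

/-! ### The repetitive system `Y(s) = G₁(s) U(s) + G₂(s) D(s)` -/

/-- The data of the system: the transfer function matrices `G₁` and `G₂`, and the transform `D(s)`
of the additional input (disturbance and initial condition). -/
structure ILCSystem (q p m : ℕ) where
  G₁ : Matrix (Fin q) (Fin p) (RatFunc ℝ)
  G₂ : Matrix (Fin q) (Fin m) (RatFunc ℝ)
  D : Matrix (Fin m) (Fin 1) (RatFunc ℝ)

namespace ILCSystem

variable {q p m : ℕ}

/-- `G₁` and `G₂` are strictly proper. -/
def C1 (S : ILCSystem q p m) : Prop :=
  IsStrictlyProper S.G₁ ∧ IsStrictlyProper S.G₂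

/-- `D(s) = d₀ + D̂(s)` with a nonzero constant vector `d₀` and a strictly proper vector `D̂`. -/
def C2 (S : ILCSystem q p m) : Prop :=
  ∃ (d₀ : Fin m → ℝ) (Dhat : Matrix (Fin m) (Fin 1) (RatFunc ℝ)),
    d₀ ≠ 0 ∧ IsStrictlyProper Dhat ∧
    S.D = Matrix.of (fun i _ => RatFunc.C (d₀ i)) + Dhat

/-- `G₁` has relative degree one. -/
def C3 (S : ILCSystem q p m) : Prop :=
  HasRelativeDegree S.G₁ 1

/-- The signals `u` and `y` on `[0, ∞)` have Laplace transforms `U` and `Y`, and these satisfy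
`G₁(s) U(s) = Y(s) - G₂(s) D(s)` for all complex `s` of large real part. -/
def FrequencyEquation (S : ILCSystem q p m) (u : ℝ → Fin p → ℝ) (y : ℝ → Fin q → ℝ) : Prop :=
  HasLaplaceTransform u ∧ HasLaplaceTransform y ∧
  ∃ σ : ℝ, ∀ s : ℂ, σ < s.re →
    ratEval S.G₁ s *ᵥ laplaceTransform u s =
      laplaceTransform y s - (ratEval S.G₂ s * ratEval S.D s).col 0

/-- On the time interval `[0, T]`, the input `u` makes the system generate the output `y`: the two
are the restrictions to `[0, T]` of signals on `[0, ∞)` whose Laplace transforms satisfy the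
frequency-domain equation of the system. The values of `u` and `y` off `[0, T]` are irrelevant. -/
def Generates (S : ILCSystem q p m) (T : ℝ) (u : ℝ → Fin p → ℝ) (y : ℝ → Fin q → ℝ) : Prop :=
  ∃ (u' : ℝ → Fin p → ℝ) (y' : ℝ → Fin q → ℝ),
    Set.EqOn u' u (Set.Icc 0 T) ∧ Set.EqOn y' y (Set.Icc 0 T) ∧ S.FrequencyEquation u' y'

/-- `yd` is trackable on `[0, T]`: some input generates it. -/
def Trackable (S : ILCSystem q p m) (T : ℝ) (yd : ℝ → Fin q → ℝ) : Prop :=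
  ∃ ud : ℝ → Fin p → ℝ, S.Generates T ud yd

/-- `yd` is realizable on `[0, T]`: exactly one input on `[0, T]` generates it, where inputs are
identified if they agree almost everywhere on `[0, T]`. -/
def Realizable (S : ILCSystem q p m) (T : ℝ) (yd : ℝ → Fin q → ℝ) : Prop :=
  ∃ ud : ℝ → Fin p → ℝ, S.Generates T ud yd ∧
    ∀ v : ℝ → Fin p → ℝ, S.Generates T v yd →
      v =ᵐ[volume.restrict (Set.Icc 0 T)] ud

end ILCSystem

end

/-!
The Laplace transform turns both questions into linear algebra over functions that are rational near
infinity. Let `M` be the limit of `s G₁(s)`.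

If `p ≤ q`, then `M` has a left inverse `L`, and `s L G₁(s)` is a proper rational matrix with value
`1` at infinity; its inverse is `1 + B` with `B` strictly proper. Two inputs that generate the same
output on `[0, T]` differ by a signal with transform `W`, where `W / s = (1 + B) L Z` and `Z` is the
transform of a signal that vanishes on `[0, T]`. By the convolution theorem the right-hand side is
the transform of a signal vanishing on `[0, T]`; by injectivity of the transform, so does the
primitive of the difference of the inputs, hence that difference itself
(`ILCSystem.FrequencyEquation.ae_eq_of_eqOn`).

If `q < p`, then `M` has a right inverse `R`, and with the inverse `1 + B` of `s G₁(s) R` the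
input `U = R (1 + B) s (Y - G₂ D)` generates `Y`. It has to be shown that `s (Y - G₂ D)` is a
Laplace transform. Up to transforms it is the constant `y_d(0) - c`, where `c` is the initial value
of the response to the additional input (`exists_extension`, `ILCSystem.exists_free_response`).
The initial value theorem, applied to an output of the system, gives `y_k(0) = c`
(`ILCSystem.FrequencyEquation.eq_initial`), so this constant is `0`. The input is not unique, since
a vector `n ≠ 0` in the kernel of `M` is the initial value of a signal whose transform lies in the
kernel of `G₁` (`exists_transform_mem_ker`).

Three facts on Laplace transforms carry this: strictly proper rational functions are transforms of
real signals (`isRealTransform_div`), the initial value theorem (`HasTransform.tendsto_mul`), and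
injectivity (`HasTransform.ae_eq_zero`).
-/

/-! ### Laplace transforms of scalar signals -/

/-- The filter of right half planes `{s | σ < Re s}`: a property holds eventually along it when it
holds for all `s` of sufficiently large real part. -/
def reAtTop : Filter ℂ := comap Complex.re atTop

/-- The function `F` is, on some right half plane, the (absolutely convergent) Laplace transform
of `f`. Only the values of `F` at points of large real part matter. -/
def HasTransform (f : ℝ → ℂ) (F : ℂ → ℂ) : Prop :=
  ∀ᶠ s in reAtTop, IntegrableOn (fun t : ℝ => Complex.exp (-s * t) * f t) (Set.Ioi 0) ∧
    ∫ t in Set.Ioi (0 : ℝ), Complex.exp (-s * t) * f t = F s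

/-- `F` is, on some right half plane, the Laplace transform of a real signal. -/
def IsRealTransform (F : ℂ → ℂ) : Prop :=
  ∃ f : ℝ → ℝ, HasTransform (fun t => (f t : ℂ)) F

theorem eventually_reAtTop {P : ℂ → Prop} :
    (∀ᶠ s in reAtTop, P s) ↔ ∃ σ : ℝ, ∀ s : ℂ, σ < s.re → P s := by
  have := ((atTop_basis_Ioi (α := ℝ)).comap Complex.re).eventually_iff (q := P)
  simpa [reAtTop] using this

theorem reAtTop_le_cobounded : reAtTop ≤ Bornology.cobounded ℂ := by
  rw [← tendsto_id', ← tendsto_norm_atTop_iff_cobounded]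
  exact tendsto_atTop_mono Complex.re_le_norm tendsto_comap

theorem tendsto_ofReal_reAtTop : Tendsto (fun x : ℝ => (x : ℂ)) atTop reAtTop :=
  tendsto_comap_iff.2 (by simpa [Function.comp_def] using! tendsto_id)

theorem tendsto_conj_reAtTop : Tendsto (starRingEnd ℂ) reAtTop reAtTop :=
  tendsto_comap_iff.2 (by
    simpa [Function.comp_def] using! (tendsto_comap : Tendsto Complex.re reAtTop atTop))

theorem eventually_ne_reAtTop (a : ℂ) : ∀ᶠ s in reAtTop, s ≠ a :=
  eventually_reAtTop.2 ⟨a.re, fun s hs h => by simp [h] at hs⟩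

namespace HasTransform

variable {f g : ℝ → ℂ} {F G : ℂ → ℂ}

theorem congr (h : HasTransform f F) (e : F =ᶠ[reAtTop] G) : HasTransform f G := by
  filter_upwards [h, e] with s hs es
  exact ⟨hs.1, hs.2.trans es⟩

theorem add (hf : HasTransform f F) (hg : HasTransform g G) :
    HasTransform (fun t => f t + g t) (fun s => F s + G s) := by
  filter_upwards [hf, hg] with s hs hs'
  simp only [mul_add]
  exact ⟨hs.1.add hs'.1, by rw [integral_add hs.1 hs'.1, hs.2, hs'.2]⟩

theorem const_mul (c : ℂ) (hf : HasTransform f F) :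
    HasTransform (fun t => c * f t) (fun s => c * F s) := by
  filter_upwards [hf] with s hs
  simp only [mul_left_comm _ c]
  exact ⟨hs.1.const_mul c, by rw [integral_const_mul, hs.2]⟩

theorem sub (hf : HasTransform f F) (hg : HasTransform g G) :
    HasTransform (fun t => f t - g t) (fun s => F s - G s) := by
  simpa [sub_eq_add_neg] using! hf.add (hg.const_mul (-1))

protected theorem zero : HasTransform (fun _ => 0) (fun _ => 0) :=
  Eventually.of_forall fun s => by simp

theorem sum {ι : Type*} (S : Finset ι) {f : ι → ℝ → ℂ} {F : ι → ℂ → ℂ}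
    (h : ∀ i ∈ S, HasTransform (f i) (F i)) :
    HasTransform (fun t => ∑ i ∈ S, f i t) (fun s => ∑ i ∈ S, F i s) := by
  classical
  induction S using Finset.induction_on with
  | empty => simpa using HasTransform.zero
  | insert a S ha ih =>
    simp only [Finset.sum_insert ha]
    exact (h a (by simp)).add (ih fun i hi => h i (by simp [hi]))

/-- The convolution theorem. -/
theorem mul (hf : HasTransform f F) (hg : HasTransform g G) :
    HasTransform (fun t => ∫ r in (0 : ℝ)..t, f r * g (t - r)) (fun s => F s * G s) := by
  filter_upwards [hf, hg] with s hs hs'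
  have key : ∀ t : ℝ, Complex.exp (-s * t) * ∫ r in (0 : ℝ)..t, f r * g (t - r) =
      ∫ r in (0 : ℝ)..t, ContinuousLinearMap.mul ℝ ℂ (Complex.exp (-s * r) * f r)
        (Complex.exp (-s * (t - r : ℝ)) * g (t - r)) := by
    intro t
    rw [← intervalIntegral.integral_const_mul]
    congr 1 with r
    have : Complex.exp (-s * t) = Complex.exp (-s * r) * Complex.exp (-s * (t - r : ℝ)) := by
      rw [← Complex.exp_add]; congr 1; push_cast; ring
    rw [this, ContinuousLinearMap.mul_apply']; ring
  simp only [key]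
  refine ⟨?_, ?_⟩
  · have := (integrable_posConvolution hs.1 hs'.1 (ContinuousLinearMap.mul ℝ ℂ))
    rwa [posConvolution, integrable_indicator_iff measurableSet_Ioi] at this
  · rw [integral_posConvolution hs.1 hs'.1, hs.2, hs'.2, ContinuousLinearMap.mul_apply']

theorem exp (a : ℂ) : HasTransform (fun t => Complex.exp (a * t)) (fun s => 1 / (s - a)) := by
  refine eventually_reAtTop.2 ⟨a.re, fun s hs => ?_⟩
  have h : (a - s).re < 0 := by simpa using hs
  have e : (fun t : ℝ => Complex.exp (-s * t) * Complex.exp (a * t)) =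
      fun t : ℝ => Complex.exp ((a - s) * t) := by
    ext t; rw [← Complex.exp_add]; congr 1; ring
  rw [e]
  refine ⟨integrableOn_exp_mul_complex_Ioi h 0, ?_⟩
  rw [integral_exp_mul_complex_Ioi h]
  simp only [Complex.ofReal_zero, mul_zero, Complex.exp_zero]
  rw [← neg_sub s a, neg_div_neg_eq]

protected theorem one : HasTransform (fun _ => 1) (fun s => 1 / s) := by
  simpa using HasTransform.exp 0

/-- The conjugate signal has the transform `conj (F (conj s))`. -/
theorem conj (hf : HasTransform f F) :
    HasTransform (fun t => starRingEnd ℂ (f t)) (fun s => starRingEnd ℂ (F (starRingEnd ℂ s))) := by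
  filter_upwards [tendsto_conj_reAtTop.eventually hf] with s hs
  have e : ∀ t : ℝ, Complex.exp (-s * t) * starRingEnd ℂ (f t) =
      starRingEnd ℂ (Complex.exp (-(starRingEnd ℂ s) * t) * f t) := by
    intro t; simp [← Complex.exp_conj]
  simp only [e]
  refine ⟨?_, by rw [integral_conj, hs.2]⟩
  exact (LinearIsometryEquiv.integrable_comp_iff Complex.conjLIE).2 hs.1

/-- A transform that commutes with conjugation is the transform of the real part of its signal. -/
theorem isRealTransform (hf : HasTransform f F)
    (hF : ∀ᶠ s in reAtTop, F (starRingEnd ℂ s) = starRingEnd ℂ (F s)) : IsRealTransform F := by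
  refine ⟨fun t => (f t).re, ?_⟩
  have := ((hf.add hf.conj).const_mul (1 / 2)).congr (G := F) (by
    filter_upwards [hF] with s hs
    rw [hs, Complex.conj_conj]; ring)
  convert! this using 2 with t
  rw [Complex.add_conj]; push_cast; ring

/-- Absolute convergence at one real point gives absolute convergence in the half plane to its
right. -/
theorem integrableOn_of_le {σ : ℝ} {s : ℂ} (hs : σ ≤ s.re)
    (h : IntegrableOn (fun t : ℝ => Complex.exp (-(σ : ℂ) * t) * f t) (Set.Ioi 0)) :
    IntegrableOn (fun t : ℝ => Complex.exp (-s * t) * f t) (Set.Ioi 0) := by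
  have e : ∀ t : ℝ, Complex.exp (-s * t) * f t =
      Complex.exp (-(s - σ) * t) * (Complex.exp (-(σ : ℂ) * t) * f t) := by
    intro t; rw [← mul_assoc, ← Complex.exp_add]; congr 2; ring
  simp only [e]
  refine Integrable.bdd_mul (c := 1) h (by fun_prop) ?_
  filter_upwards [ae_restrict_mem measurableSet_Ioi] with t ht
  rw [Complex.norm_exp]
  have : 0 ≤ (s.re - σ) * t := mul_nonneg (by linarith) (le_of_lt ht)
  simpa using by linarith

end HasTransform

theorem hasTransform_laplaceTransform {n : ℕ} {f : ℝ → Fin n → ℝ} (h : HasLaplaceTransform f)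
    (i : Fin n) : HasTransform (fun t => (f t i : ℂ)) (fun s => laplaceTransform f s i) := by
  obtain ⟨σ, hσ⟩ := h
  refine eventually_reAtTop.2 ⟨σ, fun s hs => ⟨?_, rfl⟩⟩
  refine HasTransform.integrableOn_of_le hs.le ?_
  have := (Integrable.eval hσ i).ofReal (𝕜 := ℂ)
  refine this.congr (Eventually.of_forall fun t => ?_)
  simp

theorem hasLaplaceTransform_of_hasTransform {n : ℕ} {f : ℝ → Fin n → ℝ} {F : Fin n → ℂ → ℂ}
    (h : ∀ i, HasTransform (fun t => (f t i : ℂ)) (F i)) :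
    HasLaplaceTransform f ∧ ∀ᶠ s in reAtTop, ∀ i, laplaceTransform f s i = F i s := by
  have h' := eventually_all.2 h
  refine ⟨?_, h'.mono fun s hs i => (hs i).2⟩
  obtain ⟨σ, hσ⟩ := (tendsto_ofReal_reAtTop.eventually h').exists
  refine ⟨σ, Integrable.of_eval fun i => ?_⟩
  refine ((hσ i).1).re.congr (Eventually.of_forall fun t => ?_)
  have : Complex.exp (-(σ : ℂ) * t) * (f t i : ℂ) = ((Real.exp (-σ * t) * f t i : ℝ) : ℂ) := by
    push_cast; rfl
  exact (congrArg Complex.re this).trans (Complex.ofReal_re _)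

namespace IsRealTransform

variable {F G : ℂ → ℂ}

theorem congr (h : IsRealTransform F) (e : F =ᶠ[reAtTop] G) : IsRealTransform G :=
  h.imp fun _ hf => hf.congr e

theorem add (hF : IsRealTransform F) (hG : IsRealTransform G) :
    IsRealTransform (fun s => F s + G s) := by
  obtain ⟨⟨f, hf⟩, ⟨g, hg⟩⟩ := hF, hG
  exact ⟨fun t => f t + g t, by simpa using hf.add hg⟩

theorem const_mul (c : ℝ) (hF : IsRealTransform F) : IsRealTransform (fun s => c * F s) := by
  obtain ⟨f, hf⟩ := hF
  exact ⟨fun t => c * f t, by simpa using hf.const_mul c⟩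

theorem sub (hF : IsRealTransform F) (hG : IsRealTransform G) :
    IsRealTransform (fun s => F s - G s) := by
  obtain ⟨⟨f, hf⟩, ⟨g, hg⟩⟩ := hF, hG
  exact ⟨fun t => f t - g t, by simpa using hf.sub hg⟩

theorem mul (hF : IsRealTransform F) (hG : IsRealTransform G) :
    IsRealTransform (fun s => F s * G s) := by
  obtain ⟨⟨f, hf⟩, ⟨g, hg⟩⟩ := hF, hG
  refine ⟨fun t => ∫ r in (0 : ℝ)..t, f r * g (t - r), ?_⟩
  simpa [← intervalIntegral.integral_ofReal] using hf.mul hg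

theorem sum {ι : Type*} (S : Finset ι) {F : ι → ℂ → ℂ} (h : ∀ i ∈ S, IsRealTransform (F i)) :
    IsRealTransform (fun s => ∑ i ∈ S, F i s) := by
  choose! f hf using h
  exact ⟨fun t => ∑ i ∈ S, f i t, by simpa using HasTransform.sum S hf⟩

end IsRealTransform

/-! ### Initial values -/

namespace HasTransform

variable {f : ℝ → ℂ} {F : ℂ → ℂ}

/-- The transform tends to `0` along the positive real axis. -/
theorem tendsto_zero (hf : HasTransform f F) :
    Tendsto (fun x : ℝ => F x) atTop (𝓝 0) := by
  obtain ⟨σ, hσ⟩ := eventually_atTop.1 (tendsto_ofReal_reAtTop.eventually hf)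
  have key : Tendsto (fun x : ℝ => ∫ t in Set.Ioi (0 : ℝ), Complex.exp (-(x : ℂ) * t) * f t)
      atTop (𝓝 (∫ t in Set.Ioi (0 : ℝ), 0)) := by
    refine tendsto_integral_filter_of_dominated_convergence
      (fun t => ‖Complex.exp (-(σ : ℂ) * t) * f t‖) ?_ ?_ (hσ σ le_rfl).1.norm ?_
    · filter_upwards [eventually_ge_atTop σ] with x hx using (hσ x hx).1.1
    · filter_upwards [eventually_ge_atTop σ] with x hx
      filter_upwards [ae_restrict_mem measurableSet_Ioi] with t ht
      rw [norm_mul, norm_mul]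
      gcongr
      rw [Complex.norm_exp, Complex.norm_exp, Real.exp_le_exp]
      have : 0 ≤ (x - σ) * t := mul_nonneg (by linarith) (le_of_lt ht)
      simpa using by linarith
    · filter_upwards [ae_restrict_mem measurableSet_Ioi] with t ht
      rw [← zero_mul (f t)]
      refine Tendsto.mul_const _ ?_
      rw [tendsto_zero_iff_norm_tendsto_zero]
      have : Tendsto (fun x : ℝ => Real.exp (-(x * t))) atTop (𝓝 0) :=
        Real.tendsto_exp_neg_atTop_nhds_zero.comp (tendsto_id.atTop_mul_const ht)
      simpa [Complex.norm_exp] using this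
  rw [integral_zero] at key
  refine key.congr' ?_
  filter_upwards [eventually_ge_atTop σ] with x hx using (hσ x hx).2

/-- Initial value theorem for the limit `0`, the case that the general one reduces to. -/
theorem tendsto_mul_of_tendsto_zero (hf : HasTransform f F)
    (h : Tendsto f (𝓝[>] 0 ⊓ ae volume) (𝓝 0)) :
    Tendsto (fun x : ℝ => (x : ℂ) * F x) atTop (𝓝 0) := by
  obtain ⟨σ, hσ⟩ := eventually_atTop.1 (tendsto_ofReal_reAtTop.eventually hf)
  rw [Metric.tendsto_nhds]
  intro ε hε
  have h1 := (Metric.tendsto_nhds.1 h) (ε / 2) (by positivity)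
  obtain ⟨A, hA, B, hB, hAB⟩ := mem_inf_iff_superset.1 h1
  obtain ⟨δ, hδ, hδA⟩ := mem_nhdsGT_iff_exists_Ioo_subset.1 hA
  replace hδ : 0 < δ := hδ
  set C := ∫ t in Set.Ioi (0 : ℝ), ‖Complex.exp (-(σ : ℂ) * t) * f t‖ with hC
  have hlim : Tendsto (fun x : ℝ => x * (Real.exp (-(x - σ) * δ) * C)) atTop (𝓝 0) := by
    have h2 := ((Real.tendsto_pow_mul_exp_neg_atTop_nhds_zero 1).comp
      (tendsto_id.atTop_mul_const hδ)).mul_const (Real.exp (σ * δ) * C / δ)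
    rw [zero_mul] at h2
    refine h2.congr fun x => ?_
    have : Real.exp (-(x - σ) * δ) = Real.exp (-(x * δ)) * Real.exp (σ * δ) := by
      rw [← Real.exp_add]; congr 1; ring
    simp only [Function.comp, id, pow_one, this]
    field_simp
  filter_upwards [eventually_ge_atTop σ, eventually_gt_atTop 0,
    (Metric.tendsto_nhds.1 hlim) (ε / 2) (by positivity)] with x hx hx0 hxε
  have hint1 : IntegrableOn (fun t : ℝ => ε / 2 * Real.exp (-x * t)) (Set.Ioi 0) :=
    (integrableOn_exp_mul_Ioi (by linarith) 0).const_mul _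
  have hint2 : IntegrableOn (fun t : ℝ => Real.exp (-(x - σ) * δ) *
      ‖Complex.exp (-(σ : ℂ) * t) * f t‖) (Set.Ioi 0) := (hσ σ le_rfl).1.norm.const_mul _
  -- On `(0, δ)` the signal is bounded by `ε / 2`; beyond `δ` the kernel `e^{-xt}` is at most
  -- `e^{-(x - σ) δ} e^{-σt}`, which decays in `x` faster than `1 / x`.
  have hbound : ‖F x‖ ≤ ε / 2 * (1 / x) + Real.exp (-(x - σ) * δ) * C := by
    rw [← (hσ x hx).2]
    refine (norm_integral_le_integral_norm _).trans ?_
    calc _ ≤ ∫ t in Set.Ioi (0 : ℝ), (ε / 2 * Real.exp (-x * t) + Real.exp (-(x - σ) * δ) *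
          ‖Complex.exp (-(σ : ℂ) * t) * f t‖) := by
          refine integral_mono_ae (hσ x hx).1.norm (hint1.add hint2) ?_
          filter_upwards [ae_restrict_mem measurableSet_Ioi, ae_restrict_of_ae hB] with t ht htB
          have ht : 0 < t := ht
          simp only [norm_mul, Complex.norm_exp]
          simp only [neg_mul, Complex.neg_re, Complex.mul_re, Complex.ofReal_re, Complex.ofReal_im,
            mul_zero, sub_zero]
          rcases lt_or_ge t δ with hlt | hge
          · have : ‖f t‖ < ε / 2 := by simpa using hAB ⟨hδA ⟨ht, hlt⟩, htB⟩
            have h3 : Real.exp (-(x * t)) * ‖f t‖ ≤ ε / 2 * Real.exp (-(x * t)) := by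
              rw [mul_comm]; gcongr
            have : 0 ≤ Real.exp (-((x - σ) * δ)) * (Real.exp (-(σ * t)) * ‖f t‖) := by positivity
            linarith
          · have h3 : Real.exp (-(x * t)) ≤ Real.exp (-((x - σ) * δ)) * Real.exp (-(σ * t)) := by
              rw [← Real.exp_add, Real.exp_le_exp]
              nlinarith [mul_le_mul_of_nonneg_left hge (sub_nonneg.2 hx)]
            have h4 := mul_le_mul_of_nonneg_right h3 (norm_nonneg (f t))
            have : 0 ≤ ε / 2 * Real.exp (-(x * t)) := by positivity
            linarith
      _ = _ := by
          rw [integral_add hint1 hint2, integral_const_mul, integral_const_mul,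
            integral_exp_mul_Ioi (by linarith), ← hC]
          simp
  rw [dist_zero_right, norm_mul, Complex.norm_real, Real.norm_of_nonneg hx0.le]
  rw [dist_zero_right] at hxε
  calc x * ‖F x‖ ≤ x * (ε / 2 * (1 / x) + Real.exp (-(x - σ) * δ) * C) := by gcongr
    _ = ε / 2 + x * (Real.exp (-(x - σ) * δ) * C) := by field_simp
    _ < ε := by linarith [(Real.le_norm_self _).trans_lt hxε]

/-- Initial value theorem, for a signal whose limit at `0+` exists up to a null set. -/
theorem tendsto_mul {a : ℂ} (hf : HasTransform f F)
    (h : Tendsto f (𝓝[>] 0 ⊓ ae volume) (𝓝 a)) :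
    Tendsto (fun x : ℝ => (x : ℂ) * F x) atTop (𝓝 a) := by
  have h1 := (hf.sub (HasTransform.one.const_mul a)).tendsto_mul_of_tendsto_zero (by
    simpa using! h.sub_const a)
  rw [← zero_add a]
  refine (h1.add_const a).congr' ?_
  filter_upwards [eventually_ne_atTop 0] with x hx
  have : (x : ℂ) ≠ 0 := by exact_mod_cast hx
  field_simp
  ring

/-! ### Injectivity of the Laplace transform -/

open Real in
open FourierTransform in
/-- An integrable function on the line with vanishing Fourier transform vanishes almost everywhere:
by duality it is orthogonal to all test functions, each of which is the Fourier transform of a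
Schwartz function. -/
theorem _root_.ae_eq_zero_of_fourier_eq_zero {g : ℝ → ℂ} (hg : Integrable g)
    (h : ∀ ξ, 𝓕 g ξ = 0) : ∀ᵐ x, g x = 0 := by
  refine ae_eq_zero_of_integral_contDiff_smul_eq_zero hg.locallyIntegrable fun φ hφ hc => ?_
  have hc' : HasCompactSupport (Complex.ofRealCLM ∘ φ) := hc.comp_left rfl
  have hφ' : ContDiff ℝ (⊤ : ℕ∞) (Complex.ofRealCLM ∘ φ) := by fun_prop
  set Φ : SchwartzMap ℝ ℂ := hc'.toSchwartzMap hφ' with hΦ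
  set Ψ : SchwartzMap ℝ ℂ := 𝓕⁻ Φ with hΨ
  have hflip := VectorFourier.integral_fourierIntegral_smul_eq_flip (L := innerₗ ℝ)
    (μ := volume) (ν := volume) continuous_fourierChar continuous_inner
    Ψ.integrable hg
  have e1 : ∀ ξ, VectorFourier.fourierIntegral 𝐞 volume (innerₗ ℝ) Ψ ξ = φ ξ := by
    intro ξ
    have : (𝓕 Ψ : SchwartzMap ℝ ℂ) ξ = Φ ξ := by
      rw [hΨ, FourierTransform.fourier_fourierInv_eq]
    rw [SchwartzMap.fourier_coe] at this
    simpa [hΦ] using! this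
  have e2 : ∀ ξ, VectorFourier.fourierIntegral 𝐞 volume (innerₗ ℝ).flip g ξ = 0 := by
    intro ξ
    rw [flip_innerₗ]
    exact h ξ
  simp only [e1, e2, smul_zero, integral_zero] at hflip
  simpa using hflip

open FourierTransform in
/-- The signal is determined almost everywhere by its transform: on a vertical line the transform is
the Fourier transform of the damped signal. -/
theorem ae_eq_zero (hf : HasTransform f fun _ => 0) : ∀ᵐ t : ℝ, 0 < t → f t = 0 := by
  obtain ⟨σ, hσ⟩ := eventually_reAtTop.1 hf
  set g : ℝ → ℂ := (Set.Ioi 0).indicator fun t => Complex.exp (-((σ + 1 : ℝ) : ℂ) * t) * f t with hg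
  have hgi : Integrable g := (hσ _ (by simp)).1.integrable_indicator measurableSet_Ioi
  have hF : ∀ ξ, 𝓕 g ξ = 0 := by
    intro ξ
    refine Eq.trans ?_ (hσ ((σ + 1 : ℝ) + 2 * Real.pi * ξ * Complex.I) (by simp)).2
    rw [Real.fourier_eq', ← integral_indicator measurableSet_Ioi]
    congr 1 with t
    by_cases ht : t ∈ Set.Ioi (0 : ℝ)
    · simp only [hg, Set.indicator_of_mem ht]
      rw [smul_eq_mul, ← mul_assoc, ← Complex.exp_add]
      congr 2
      simp
      ring
    · simp [hg, Set.indicator_of_notMem ht]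
  filter_upwards [ae_eq_zero_of_fourier_eq_zero hgi hF] with t ht h0
  simpa [hg, Set.indicator_of_mem (show t ∈ Set.Ioi (0 : ℝ) from h0)] using ht

/-- If `F(s) / s` is the transform of a signal that vanishes on `(0, T)`, then so does the signal
with transform `F`: its primitive vanishes there, and it is the derivative of its primitive. -/
theorem ae_eq_zero_of_div {T : ℝ} (hf : HasTransform f F) {b : ℝ → ℂ}
    (hb : HasTransform b fun s => F s / s) (hb0 : ∀ᵐ t : ℝ, t ∈ Set.Ioo 0 T → b t = 0) :
    ∀ᵐ t : ℝ, t ∈ Set.Ioo 0 T → f t = 0 := by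
  rcases le_or_gt T 0 with hT | hT
  · simp [Set.Ioo_eq_empty (not_lt.2 hT)]
  have hint : IntervalIntegrable f volume 0 T := by
    obtain ⟨σ, hσ⟩ := (tendsto_ofReal_reAtTop.eventually hf).exists
    have h1 : IntervalIntegrable (fun t : ℝ => Complex.exp (-(σ : ℂ) * t) * f t) volume 0 T :=
      (intervalIntegrable_iff_integrableOn_Ioc_of_le hT.le).2
        (hσ.1.mono_set Set.Ioc_subset_Ioi_self)
    have h2 := h1.mul_continuousOn (g := fun t : ℝ => Complex.exp ((σ : ℂ) * t))
      (by fun_prop)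
    refine h2.congr fun t _ => ?_
    change Complex.exp (-(σ : ℂ) * t) * f t * Complex.exp ((σ : ℂ) * t) = f t
    rw [mul_right_comm, ← Complex.exp_add]; simp
  have ha : HasTransform (fun t => ∫ r in (0 : ℝ)..t, f r) (fun s => F s / s) := by
    simpa [div_eq_mul_inv] using hf.mul HasTransform.one
  have h0 := ((ha.sub hb).congr (G := fun _ => 0)
    (Eventually.of_forall fun s => sub_self _)).ae_eq_zero
  have hcont : ContinuousOn (fun t => ∫ r in (0 : ℝ)..t, f r) (Set.Ioo 0 T) :=
    (intervalIntegral.continuousOn_primitive_interval'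
      hint (by simp [hT.le])).mono (by rw [Set.uIcc_of_le hT.le]; exact Set.Ioo_subset_Icc_self)
  have hzero : Set.EqOn (fun t => ∫ r in (0 : ℝ)..t, f r) (fun _ => 0) (Set.Ioo 0 T) := by
    refine Measure.eqOn_open_of_ae_eq (μ := volume) ?_ isOpen_Ioo hcont continuousOn_const
    rw [EventuallyEq, ae_restrict_iff' measurableSet_Ioo]
    filter_upwards [h0, hb0] with t h1 h2 ht
    simpa [h2 ht] using h1 ht.1
  filter_upwards [hint.ae_hasDerivAt_integral] with t ht htT
  have hd := ht (by rw [Set.uIcc_of_le hT.le]; exact Set.Ioo_subset_Icc_self htT) 0 (by simp)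
  have hd0 : HasDerivAt (fun t => ∫ r in (0 : ℝ)..t, f r) 0 t :=
    (hasDerivAt_const t (0 : ℂ)).congr_of_eventuallyEq
      (hzero.eventuallyEq_of_mem (isOpen_Ioo.mem_nhds htT))
  exact hd.unique hd0

end HasTransform

/-! ### Strictly proper rational functions are Laplace transforms -/

open Polynomial in
/-- Partial fractions, one root of the denominator at a time: with `N = (X - a) N₁ + N(a)`, the
fraction `N / ((X - a) P)` is the sum of `N₁ / P` and of `N(a) / P` times `1 / (X - a)`. -/
theorem exists_hasTransform_div_prod (R : Multiset ℂ) :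
    ∀ N : ℂ[X], N.degree < R.card →
      ∃ f, HasTransform f fun s => N.eval s / (R.map fun a => s - a).prod := by
  induction R using Multiset.induction_on with
  | empty =>
    intro N hN
    have : N = 0 := by simpa [Nat.WithBot.lt_zero_iff] using hN
    exact ⟨_, by simpa [this] using HasTransform.zero⟩
  | cons a R ih =>
    intro N hN
    have hdiv : (X - C a) * (N /ₘ (X - C a)) + C (N.eval a) = N := by
      have := modByMonic_add_div N (X - C a)
      rwa [modByMonic_X_sub_C_eq_C_eval, add_comm] at this
    obtain ⟨f, hf⟩ : ∃ f, HasTransform f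
        fun s => (N /ₘ (X - C a)).eval s / (R.map fun a => s - a).prod := by
      refine ih _ ?_
      by_cases h0 : N /ₘ (X - C a) = 0
      · rw [h0, degree_zero]; exact WithBot.bot_lt_coe _
      have hle : (X - C a).degree ≤ N.degree := by
        by_contra hlt
        exact h0 ((divByMonic_eq_zero_iff (monic_X_sub_C a)).2 (not_le.1 hlt))
      have h1 := degree_add_divByMonic (monic_X_sub_C a) hle
      rw [← h1, degree_X_sub_C, Multiset.card_cons, degree_eq_natDegree h0] at hN
      rw [degree_eq_natDegree h0]
      norm_cast at hN ⊢
      omega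
    obtain ⟨g, hg⟩ : ∃ g, HasTransform g
        fun s => N.eval a / (R.map fun a => s - a).prod * (1 / (s - a)) := by
      rcases Multiset.empty_or_exists_mem R with rfl | ⟨b, hb⟩
      · exact ⟨_, by simpa using (HasTransform.exp a).const_mul (N.eval a)⟩
      · obtain ⟨g, hg⟩ := ih (C (N.eval a)) (degree_C_le.trans_lt (by
          exact_mod_cast Multiset.card_pos_iff_exists_mem.2 ⟨b, hb⟩))
        exact ⟨_, by simpa using hg.mul (HasTransform.exp a)⟩
    refine ⟨_, (hf.add hg).congr ?_⟩
    filter_upwards [eventually_ne_reAtTop a] with s hs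
    have hs' : s - a ≠ 0 := sub_ne_zero.2 hs
    conv_rhs => rw [← hdiv]
    simp only [eval_add, eval_mul, eval_sub, eval_X, eval_C, Multiset.map_cons, Multiset.prod_cons]
    rw [add_div, mul_div_mul_left _ _ hs']
    congr 1
    rw [div_mul_div_comm, mul_one, mul_comm (s - a)]

open Polynomial in
/-- A strictly proper fraction of real polynomials is a transform: over `ℂ` its denominator splits,
and since the fraction commutes with conjugation the signal may be taken real. -/
theorem isRealTransform_div {N P : ℝ[X]} (hP : P.Monic) (h : N.degree < P.degree) :
    IsRealTransform fun s => N.eval₂ (algebraMap ℝ ℂ) s / P.eval₂ (algebraMap ℝ ℂ) s := by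
  have hs : (P.map (algebraMap ℝ ℂ)).Splits := IsAlgClosed.splits _
  obtain ⟨f, hf⟩ := exists_hasTransform_div_prod (P.map (algebraMap ℝ ℂ)).roots
    (N.map (algebraMap ℝ ℂ)) (by
      rw [← hs.natDegree_eq_card_roots, natDegree_map, degree_map,
        ← degree_eq_natDegree hP.ne_zero]
      exact h)
  have hf' := hf.congr (G := fun s => N.eval₂ (algebraMap ℝ ℂ) s / P.eval₂ (algebraMap ℝ ℂ) s)
    (Eventually.of_forall fun s => by
      simp only [← eval_map, hs.eval_eq_prod_roots_of_monic (hP.map _)])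
  have hconj : ∀ (Q : ℝ[X]) (s : ℂ), Q.eval₂ (algebraMap ℝ ℂ) (starRingEnd ℂ s) =
      starRingEnd ℂ (Q.eval₂ (algebraMap ℝ ℂ) s) := by
    intro Q s
    rw [hom_eval₂]
    congr 1
    ext x; simp
  exact hf'.isRealTransform (Eventually.of_forall fun s => by simp only [hconj, map_div₀])

/-! ### Rational matrices near infinity -/

instance : reAtTop.NeBot := tendsto_ofReal_reAtTop.neBot

theorem eventually_eval₂_ne_zero {P : Polynomial ℝ} (hP : P ≠ 0) :
    ∀ᶠ s in reAtTop, P.eval₂ (algebraMap ℝ ℂ) s ≠ 0 := by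
  refine reAtTop_le_cobounded ?_
  have hfin : {s : ℂ | P.eval₂ (algebraMap ℝ ℂ) s = 0}.Finite := by
    have := (P.map (algebraMap ℝ ℂ)).roots.toFinset.finite_toSet
    refine this.subset fun s hs => ?_
    have hP' : P.map (algebraMap ℝ ℂ) ≠ 0 :=
      (Polynomial.map_ne_zero_iff (algebraMap ℝ ℂ).injective).2 hP
    simpa [hP, Polynomial.eval_map] using! hs
  exact Bornology.isBounded_def.1 hfin.isBounded

theorem eventually_denom_ne_zero (r : RatFunc ℝ) :
    ∀ᶠ s in reAtTop, r.denom.eval₂ (algebraMap ℝ ℂ) s ≠ 0 :=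
  eventually_eval₂_ne_zero r.denom_ne_zero

theorem eventually_eval_mul (r r' : RatFunc ℝ) :
    ∀ᶠ s in reAtTop, (r * r').eval (algebraMap ℝ ℂ) s =
      r.eval (algebraMap ℝ ℂ) s * r'.eval (algebraMap ℝ ℂ) s := by
  filter_upwards [eventually_denom_ne_zero r, eventually_denom_ne_zero r'] with s h h'
  exact RatFunc.eval_mul _ _ h h'

theorem eventually_eval_add (r r' : RatFunc ℝ) :
    ∀ᶠ s in reAtTop, (r + r').eval (algebraMap ℝ ℂ) s =
      r.eval (algebraMap ℝ ℂ) s + r'.eval (algebraMap ℝ ℂ) s := by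
  filter_upwards [eventually_denom_ne_zero r, eventually_denom_ne_zero r'] with s h h'
  exact RatFunc.eval_add _ _ h h'

theorem eventually_eval_sum {ι : Type*} (I : Finset ι) (r : ι → RatFunc ℝ) :
    ∀ᶠ s in reAtTop, (∑ i ∈ I, r i).eval (algebraMap ℝ ℂ) s =
      ∑ i ∈ I, (r i).eval (algebraMap ℝ ℂ) s := by
  classical
  induction I using Finset.induction_on with
  | empty => simp
  | insert a I ha ih =>
    filter_upwards [ih, eventually_eval_add (r a) (∑ i ∈ I, r i)] with s h h'
    rw [Finset.sum_insert ha, Finset.sum_insert ha, h', h]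

theorem eventually_ratEval_mul {l m n : ℕ} (A : Matrix (Fin l) (Fin m) (RatFunc ℝ))
    (B : Matrix (Fin m) (Fin n) (RatFunc ℝ)) :
    ∀ᶠ s in reAtTop, ratEval (A * B) s = ratEval A s * ratEval B s := by
  have h1 : ∀ᶠ s in reAtTop, ∀ i j, ratEval (A * B) s i j =
      ∑ k, (A i k * B k j).eval (algebraMap ℝ ℂ) s :=
    eventually_all.2 fun i => eventually_all.2 fun j => by
      simpa [ratEval, Matrix.mul_apply] using eventually_eval_sum Finset.univ fun k => A i k * B k j
  have h2 : ∀ᶠ s in reAtTop, ∀ i j k, (A i k * B k j).eval (algebraMap ℝ ℂ) s =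
      (A i k).eval (algebraMap ℝ ℂ) s * (B k j).eval (algebraMap ℝ ℂ) s :=
    eventually_all.2 fun i => eventually_all.2 fun j => eventually_all.2 fun k =>
      eventually_eval_mul _ _
  filter_upwards [h1, h2] with s h1 h2
  ext i j
  rw [h1, Matrix.mul_apply]
  exact Finset.sum_congr rfl fun k _ => h2 i j k

theorem eventually_ratEval_add {m n : ℕ} (A B : Matrix (Fin m) (Fin n) (RatFunc ℝ)) :
    ∀ᶠ s in reAtTop, ratEval (A + B) s = ratEval A s + ratEval B s := by
  have h1 : ∀ᶠ s in reAtTop, ∀ i j, (A i j + B i j).eval (algebraMap ℝ ℂ) s =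
      (A i j).eval (algebraMap ℝ ℂ) s + (B i j).eval (algebraMap ℝ ℂ) s :=
    eventually_all.2 fun i => eventually_all.2 fun j => eventually_eval_add _ _
  filter_upwards [h1] with s h1
  ext i j
  simp [h1, ratEval]

theorem eventually_ratEval_X_smul {m n : ℕ} (A : Matrix (Fin m) (Fin n) (RatFunc ℝ)) :
    ∀ᶠ s in reAtTop, ratEval ((RatFunc.X : RatFunc ℝ) • A) s = s • ratEval A s := by
  have h1 : ∀ᶠ s in reAtTop, ∀ i j, (RatFunc.X * A i j).eval (algebraMap ℝ ℂ) s =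
      s * (A i j).eval (algebraMap ℝ ℂ) s :=
    eventually_all.2 fun i => eventually_all.2 fun j => by
      simpa using eventually_eval_mul RatFunc.X (A i j)
  filter_upwards [h1] with s h1
  ext i j
  simp [h1, ratEval]

theorem ratEval_C {m n : ℕ} (M : Matrix (Fin m) (Fin n) ℝ) (s : ℂ) :
    ratEval (M.map RatFunc.C) s = M.map (fun x : ℝ => (x : ℂ)) := by
  ext i j; simp [ratEval]

theorem eq_zero_of_eventually_eval_eq_zero {r : RatFunc ℝ}
    (h : ∀ᶠ s in reAtTop, r.eval (algebraMap ℝ ℂ) s = 0) : r = 0 := by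
  by_contra hr
  obtain ⟨s, h1, h2, h3⟩ := (h.and ((eventually_eval₂_ne_zero (RatFunc.num_ne_zero hr)).and
    (eventually_denom_ne_zero r))).exists
  exact div_ne_zero h2 h3 h1

/-- Stated through values because `RatFunc.eval` is multiplicative only away from poles; a kernel
vector of `A` would, evaluated at large `s`, lie in the kernel of the invertible `A(s)`. -/
theorem det_ne_zero_of_eventually {n : ℕ} {A : Matrix (Fin n) (Fin n) (RatFunc ℝ)}
    (h : ∀ᶠ s in reAtTop, (ratEval A s).det ≠ 0) : A.det ≠ 0 := by
  intro h0
  obtain ⟨v, hv, hAv⟩ := Matrix.exists_mulVec_eq_zero_iff.2 h0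
  have hcol : A * Matrix.of (fun i (_ : Fin 1) => v i) = 0 := by
    ext i j
    simpa [Matrix.mul_apply, Matrix.mulVec, dotProduct] using congrFun hAv i
  refine hv (funext fun i => eq_zero_of_eventually_eval_eq_zero ?_)
  filter_upwards [h, eventually_ratEval_mul A (Matrix.of (fun i (_ : Fin 1) => v i))] with s hs hs'
  rw [hcol] at hs'
  have h2 : ratEval A s *ᵥ (fun i => (v i).eval (algebraMap ℝ ℂ) s) = 0 := by
    ext i
    have := congrFun (congrFun hs' i) 0
    simpa [ratEval, Matrix.mul_apply, Matrix.mulVec, dotProduct] using this.symm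
  exact congrFun (Matrix.eq_zero_of_mulVec_eq_zero hs h2) i

/-- The limit along the positive real axis suffices to bound the degree of the numerator. -/
theorem degree_num_lt_of_tendsto_zero {r : RatFunc ℝ}
    (h : Tendsto (fun s => r.eval (algebraMap ℝ ℂ) s) reAtTop (𝓝 0)) :
    r.num.degree < r.denom.degree := by
  rw [← Polynomial.div_tendsto_atTop_zero_iff_degree_lt _ _ r.denom_ne_zero]
  have h1 := (Complex.continuous_re.tendsto 0).comp (h.comp tendsto_ofReal_reAtTop)
  refine h1.congr fun x => ?_
  have e : ∀ P : Polynomial ℝ, P.eval₂ (algebraMap ℝ ℂ) (x : ℂ) = ((P.eval x : ℝ) : ℂ) := by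
    intro P
    simpa using Polynomial.eval₂_at_apply (p := P) (algebraMap ℝ ℂ) x
  simp only [Function.comp, RatFunc.eval, e]
  rw [← Complex.ofReal_div, Complex.ofReal_re]

theorem isRealTransform_eval {r : RatFunc ℝ}
    (h : Tendsto (fun s => r.eval (algebraMap ℝ ℂ) s) reAtTop (𝓝 0)) :
    IsRealTransform fun s => r.eval (algebraMap ℝ ℂ) s :=
  isRealTransform_div r.monic_denom (degree_num_lt_of_tendsto_zero h)

theorem isRealTransform_eval_sub {r : RatFunc ℝ} {c : ℝ}
    (h : Tendsto (fun s => r.eval (algebraMap ℝ ℂ) s) reAtTop (𝓝 c)) :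
    IsRealTransform fun s => r.eval (algebraMap ℝ ℂ) s - c := by
  have e : (fun s => (r + RatFunc.C (-c)).eval (algebraMap ℝ ℂ) s) =ᶠ[reAtTop]
      fun s => r.eval (algebraMap ℝ ℂ) s - c := by
    filter_upwards [eventually_eval_add r (RatFunc.C (-c))] with s hs
    rw [hs, RatFunc.eval_C]; simp [sub_eq_add_neg]
  refine (isRealTransform_eval ?_).congr e
  rw [← sub_self (c : ℂ)]
  exact (h.sub_const _).congr' (EventuallyEq.symm e)

/-- For strictly proper `r`, the function `s r(s)` is a constant (the initial value of the signal
with transform `r`) plus a strictly proper function. -/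
theorem exists_mul_eval_eq {r : RatFunc ℝ}
    (h : Tendsto (fun s => r.eval (algebraMap ℝ ℂ) s) reAtTop (𝓝 0)) :
    ∃ (c : ℝ) (Q : ℂ → ℂ), IsRealTransform Q ∧
      ∀ᶠ s in reAtTop, s * r.eval (algebraMap ℝ ℂ) s = c + Q s := by
  have hdeg := degree_num_lt_of_tendsto_zero h
  have hm := r.monic_denom
  set N := r.num with hN
  set P := r.denom with hP
  -- `P` is monic, so this is the limit of `s N(s) / P(s)`; if `P` is constant, then `N = 0` and the
  -- truncated subtraction is harmless.
  set c := N.coeff (P.natDegree - 1) with hc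
  have hlt : (Polynomial.X * N - Polynomial.C c * P).degree < P.degree := by
    rw [Polynomial.degree_eq_natDegree hm.ne_zero] at hdeg ⊢
    rw [Polynomial.degree_lt_iff_coeff_zero] at hdeg ⊢
    intro k hk
    rw [Polynomial.coeff_sub, Polynomial.coeff_C_mul]
    rcases hk.eq_or_lt with rfl | hk
    · rw [hm.coeff_natDegree]
      rcases Nat.eq_zero_or_pos P.natDegree with h0 | h0
      · have : N.coeff 0 = 0 := hdeg 0 h0.le
        simp [hc, h0, this]
      · obtain ⟨d, hd⟩ := Nat.exists_eq_add_of_lt h0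
        rw [zero_add] at hd
        rw [hc, hd, Polynomial.coeff_X_mul]; simp
    · rw [Polynomial.coeff_eq_zero_of_natDegree_lt hk, mul_zero, sub_zero]
      obtain ⟨d, rfl⟩ := Nat.exists_eq_add_of_lt hk
      rw [Polynomial.coeff_X_mul]
      exact hdeg _ (by omega)
  refine ⟨c, _, isRealTransform_div hm hlt, ?_⟩
  filter_upwards [eventually_denom_ne_zero r] with s hs
  rw [RatFunc.eval, ← hN, ← hP] at *
  simp only [Polynomial.eval₂_sub, Polynomial.eval₂_mul, Polynomial.eval₂_X, Polynomial.eval₂_C]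
  have e : algebraMap ℝ ℂ c = (c : ℂ) := rfl
  rw [e]
  field_simp
  ring

/-- A rational matrix with value `1` at infinity has an inverse of the form `1 + B`, where `B` is
strictly proper and hence the Laplace transform of a real matrix-valued signal. -/
theorem exists_transform_inverse {n : ℕ} {A : Matrix (Fin n) (Fin n) (RatFunc ℝ)}
    (h : Tendsto (ratEval A) reAtTop (𝓝 1)) :
    ∃ B : ℂ → Matrix (Fin n) (Fin n) ℂ, (∀ i j, IsRealTransform fun s => B s i j) ∧
      ∀ᶠ s in reAtTop, ratEval A s * (1 + B s) = 1 ∧ (1 + B s) * ratEval A s = 1 := by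
  have hdet : Tendsto (fun s => (ratEval A s).det) reAtTop (𝓝 1) := by
    simpa using! ((continuous_id.matrix_det).tendsto (1 : Matrix (Fin n) (Fin n) ℂ)).comp h
  have hdet0 : ∀ᶠ s in reAtTop, (ratEval A s).det ≠ 0 := hdet.eventually_ne one_ne_zero
  have hA : A * A⁻¹ = 1 :=
    Matrix.mul_nonsing_inv _ (isUnit_iff_ne_zero.2 (det_ne_zero_of_eventually hdet0))
  have hinv : ∀ᶠ s in reAtTop, ratEval A s * ratEval A⁻¹ s = 1 := by
    filter_upwards [eventually_ratEval_mul A A⁻¹] with s hs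
    rw [← hs, hA]
    ext i j
    by_cases hij : i = j <;> simp [ratEval, Matrix.one_apply, hij]
  have heq : ∀ᶠ s in reAtTop, (ratEval A s).det⁻¹ • (ratEval A s).adjugate = ratEval A⁻¹ s := by
    filter_upwards [hinv] with s hs
    rw [← Matrix.inv_eq_right_inv hs, Matrix.inv_def, Ring.inverse_eq_inv']
  have hlim : Tendsto (ratEval A⁻¹) reAtTop (𝓝 1) := by
    have hadj := ((continuous_id.matrix_adjugate).tendsto (1 : Matrix (Fin n) (Fin n) ℂ)).comp h
    have := (hdet.inv₀ one_ne_zero).smul hadj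
    simp only [id, Matrix.adjugate_one, inv_one, one_smul] at this
    exact this.congr' heq
  refine ⟨fun s => ratEval A⁻¹ s - 1, fun i j => ?_, ?_⟩
  · have hij := tendsto_pi_nhds.1 (tendsto_pi_nhds.1 hlim i) j
    have := isRealTransform_eval_sub (r := A⁻¹ i j) (c := (1 : Matrix (Fin n) (Fin n) ℝ) i j) (by
      convert! hij using 2
      by_cases e : i = j <;> simp [Matrix.one_apply, e])
    convert! this using 2 with s
    by_cases e : i = j <;> simp [Matrix.one_apply, e, ratEval]
  · filter_upwards [hinv] with s hs
    rw [add_sub_cancel]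
    exact ⟨hs, mul_eq_one_comm.1 hs⟩

/-! ### Matrices of relative degree one -/

section RelativeDegreeOne

variable {q p : ℕ} {G : Matrix (Fin q) (Fin p) (RatFunc ℝ)} {M : Matrix (Fin q) (Fin p) ℝ}

theorem exists_transform_inverse_smul {n : ℕ} {N : Matrix (Fin n) (Fin n) (RatFunc ℝ)}
    {H : ℂ → Matrix (Fin n) (Fin n) ℂ} (hN : ratEval N =ᶠ[reAtTop] H)
    (h : Tendsto (fun s : ℂ => s • H s) reAtTop (𝓝 1)) :
    ∃ B : ℂ → Matrix (Fin n) (Fin n) ℂ, (∀ i j, IsRealTransform fun s => B s i j) ∧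
      ∀ᶠ s in reAtTop, (s • H s) * (1 + B s) = 1 ∧ (1 + B s) * (s • H s) = 1 := by
  have e : ∀ᶠ s in reAtTop, ratEval ((RatFunc.X : RatFunc ℝ) • N) s = s • H s := by
    filter_upwards [eventually_ratEval_X_smul N, hN] with s h1 h2
    rw [h1, h2]
  obtain ⟨B, hB, hB'⟩ := exists_transform_inverse (h.congr' (EventuallyEq.symm e))
  refine ⟨B, hB, ?_⟩
  filter_upwards [hB', e] with s h1 h2
  rwa [← h2]

/-- For `L M = 1`, the matrix `s L G(s)` has value `L M = 1` at infinity. -/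
theorem exists_transform_left_inverse
    (h : Tendsto (fun s : ℂ => s • ratEval G s) reAtTop (𝓝 (M.map (fun x : ℝ => (x : ℂ)))))
    {L : Matrix (Fin p) (Fin q) ℝ} (hL : L * M = 1) :
    ∃ B : ℂ → Matrix (Fin p) (Fin p) ℂ, (∀ i j, IsRealTransform fun s => B s i j) ∧
      ∀ᶠ s in reAtTop,
        (1 + B s) * (s • (L.map (fun x : ℝ => (x : ℂ)) * ratEval G s)) = 1 := by
  have h1 := ((Continuous.matrix_mul (A := fun _ => L.map (fun x : ℝ => (x : ℂ)))
    continuous_const continuous_id).tendsto _).comp h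
  have h2 : L.map (fun x : ℝ => (x : ℂ)) * M.map (fun x : ℝ => (x : ℂ)) = 1 := by
    have := congrArg (fun N => N.map Complex.ofRealHom) hL
    simpa [Matrix.map_mul] using! this
  obtain ⟨B, hB, hB'⟩ := exists_transform_inverse_smul (N := L.map RatFunc.C * G)
    (H := fun s => L.map (fun x : ℝ => (x : ℂ)) * ratEval G s) (by
      filter_upwards [eventually_ratEval_mul (L.map RatFunc.C) G] with s hs
      rw [hs, ratEval_C]) (by
      simpa [h2, Function.comp_def] using h1)
  exact ⟨B, hB, hB'.mono fun s hs => hs.2⟩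

/-- For `M R = 1`, the matrix `s G(s) R` has value `M R = 1` at infinity. -/
theorem exists_transform_right_inverse
    (h : Tendsto (fun s : ℂ => s • ratEval G s) reAtTop (𝓝 (M.map (fun x : ℝ => (x : ℂ)))))
    {R : Matrix (Fin p) (Fin q) ℝ} (hR : M * R = 1) :
    ∃ B : ℂ → Matrix (Fin q) (Fin q) ℂ, (∀ i j, IsRealTransform fun s => B s i j) ∧
      ∀ᶠ s in reAtTop,
        (s • (ratEval G s * R.map (fun x : ℝ => (x : ℂ)))) * (1 + B s) = 1 := by
  have h1 := ((Continuous.matrix_mul (B := fun _ => R.map (fun x : ℝ => (x : ℂ)))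
    continuous_id continuous_const).tendsto _).comp h
  have h2 : M.map (fun x : ℝ => (x : ℂ)) * R.map (fun x : ℝ => (x : ℂ)) = 1 := by
    have := congrArg (fun N => N.map Complex.ofRealHom) hR
    simpa [Matrix.map_mul] using! this
  obtain ⟨B, hB, hB'⟩ := exists_transform_inverse_smul (N := G * R.map RatFunc.C)
    (H := fun s => ratEval G s * R.map (fun x : ℝ => (x : ℂ))) (by
      filter_upwards [eventually_ratEval_mul G (R.map RatFunc.C)] with s hs
      rw [hs, ratEval_C]) (by
      simpa [h2, Function.comp_def] using h1)
  exact ⟨B, hB, hB'.mono fun s hs => hs.1⟩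

/-- If the leading coefficient `M` of `G` has a nontrivial kernel, then so has `G`: for `M n = 0`
and a right inverse `R` of `M`, the vector `n - R (s G R)⁻¹ (s G) n` is annihilated by `G` and
tends to `n`. Division by `s` makes it the transform of a signal with initial value `n`. -/
theorem exists_transform_mem_ker
    (h : Tendsto (fun s : ℂ => s • ratEval G s) reAtTop (𝓝 (M.map (fun x : ℝ => (x : ℂ)))))
    {R : Matrix (Fin p) (Fin q) ℝ} (hR : M * R = 1) {n : Fin p → ℝ} (hn : M *ᵥ n = 0) :
    ∃ V : ℂ → Fin p → ℂ, (∀ j, IsRealTransform fun s => V s j) ∧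
      (∀ᶠ s in reAtTop, ratEval G s *ᵥ V s = 0) ∧
      ∀ j, Tendsto (fun x : ℝ => (x : ℂ) * V x j) atTop (𝓝 (n j)) := by
  obtain ⟨B, hB, hBinv⟩ := exists_transform_right_inverse h hR
  set nc : Fin p → ℂ := fun j => n j with hnc
  set Rc := R.map (fun x : ℝ => (x : ℂ)) with hRc
  have hH : ∀ i, IsRealTransform fun s => ((s • ratEval G s) *ᵥ nc) i := by
    intro i
    set W := (RatFunc.X : RatFunc ℝ) • (G * (Matrix.of fun j (_ : Fin 1) => n j).map RatFunc.C)
      with hW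
    have e : ∀ᶠ s in reAtTop, (W i 0).eval (algebraMap ℝ ℂ) s =
        ((s • ratEval G s) *ᵥ nc) i := by
      filter_upwards [eventually_ratEval_X_smul
        (G * (Matrix.of fun j (_ : Fin 1) => n j).map RatFunc.C), eventually_ratEval_mul G
        ((Matrix.of fun j (_ : Fin 1) => n j).map RatFunc.C)] with s h1 h2
      rw [h2, ratEval_C] at h1
      have := congrFun (congrFun h1 i) 0
      simp only [Matrix.smul_mulVec]
      simpa [Matrix.mul_apply, Matrix.mulVec, dotProduct, ratEval] using! this
    refine (isRealTransform_eval ?_).congr e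
    refine Tendsto.congr' (EventuallyEq.symm e) ?_
    have h1 := ((Continuous.matrix_mulVec (B := fun _ => nc)
      continuous_id continuous_const).tendsto _).comp h
    have h2 : M.map (fun x : ℝ => (x : ℂ)) *ᵥ nc = 0 := by
      ext i
      have := congrArg (fun x : ℝ => (x : ℂ)) (congrFun hn i)
      simpa [Matrix.mulVec, dotProduct, hnc] using this
    simp only [id] at h1
    rw [h2] at h1
    exact tendsto_pi_nhds.1 h1 i
  set E : ℂ → Fin p → ℂ := fun s => Rc *ᵥ ((1 + B s) *ᵥ ((s • ratEval G s) *ᵥ nc)) with hE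
  have hEt : ∀ j, IsRealTransform fun s => E s j := by
    intro j
    have : (fun s => E s j) = fun s => ∑ i, ((R j i : ℝ) : ℂ) * (((s • ratEval G s) *ᵥ nc) i +
        ∑ k, B s i k * ((s • ratEval G s) *ᵥ nc) k) := by
      ext s
      simp only [hE, Matrix.add_mulVec, Matrix.one_mulVec]
      rfl
    rw [this]
    exact IsRealTransform.sum _ fun i _ => IsRealTransform.const_mul _
      ((hH i).add (IsRealTransform.sum _ fun k _ => (hB i k).mul (hH k)))
  have hone : IsRealTransform fun s => 1 / s := ⟨fun _ => 1, by simpa using HasTransform.one⟩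
  refine ⟨fun s => (1 / s) • (nc - E s), fun j => ?_, ?_, fun j => ?_⟩
  · have := (hone.const_mul (n j)).sub (hone.mul (hEt j))
    refine this.congr (Eventually.of_forall fun s => ?_)
    simp [hnc]; ring
  · filter_upwards [hBinv, eventually_ne_reAtTop 0] with s hs h0
    have h1 : s • (ratEval G s *ᵥ E s) = s • (ratEval G s *ᵥ nc) := by
      rw [hE, ← Matrix.smul_mulVec, Matrix.mulVec_mulVec, Matrix.mulVec_mulVec, Matrix.smul_mul,
        hs, Matrix.one_mulVec, Matrix.smul_mulVec]
    rw [Matrix.mulVec_smul, Matrix.mulVec_sub, smul_right_injective _ h0 h1, sub_self, smul_zero]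
  · obtain ⟨f, hf⟩ := hEt j
    have h1 := hf.tendsto_zero.const_sub (n j : ℂ)
    rw [sub_zero] at h1
    refine h1.congr' ?_
    filter_upwards [eventually_ne_atTop 0] with x hx
    have : (x : ℂ) ≠ 0 := by exact_mod_cast hx
    simp only [Pi.smul_apply, Pi.sub_apply, smul_eq_mul, hnc]
    field_simp

end RelativeDegreeOne

/-! ### The repetitive system -/

/-- Since `G₂(s) → 0` and `D(s) → d₀`, the product `G₂ D` is strictly proper, which makes
`s G₂(s) D(s)` a constant vector `c`, the initial value of the response to the additional input,
plus a strictly proper vector. -/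
theorem ILCSystem.exists_free_response {q p m : ℕ} {S : ILCSystem q p m} (hC1 : S.C1)
    (hC2 : S.C2) :
    ∃ (c : Fin q → ℝ) (Q : Fin q → ℂ → ℂ), (∀ i, IsRealTransform (Q i)) ∧
      ∀ᶠ s in reAtTop, ∀ i, s * (ratEval S.G₂ s * ratEval S.D s).col 0 i = c i + Q i s := by
  obtain ⟨d₀, Dhat, -, hD0, hD⟩ := hC2
  have hDlim : Tendsto (ratEval S.D) reAtTop
      (𝓝 ((Matrix.of fun i (_ : Fin 1) => d₀ i).map (fun x : ℝ => (x : ℂ)))) := by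
    have h1 : ∀ᶠ s in reAtTop, (Matrix.of fun i (_ : Fin 1) => d₀ i).map (fun x : ℝ => (x : ℂ)) +
        ratEval Dhat s = ratEval S.D s := by
      filter_upwards [eventually_ratEval_add
        ((Matrix.of fun i (_ : Fin 1) => d₀ i).map RatFunc.C) Dhat] with s hs
      rw [ratEval_C] at hs
      rw [hD, ← hs]
      rfl
    have h2 := (hD0.mono_left reAtTop_le_cobounded).const_add
      ((Matrix.of fun i (_ : Fin 1) => d₀ i).map (fun x : ℝ => (x : ℂ)))
    rw [add_zero] at h2
    exact h2.congr' h1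
  have hmul := eventually_ratEval_mul S.G₂ S.D
  have hlim : Tendsto (fun s => ratEval S.G₂ s * ratEval S.D s) reAtTop (𝓝 0) := by
    have := ((Continuous.matrix_mul continuous_fst continuous_snd).tendsto _).comp
      ((hC1.2.mono_left reAtTop_le_cobounded).prodMk_nhds hDlim)
    simpa [Function.comp_def] using! this
  have hr : ∀ i, Tendsto (fun s => ((S.G₂ * S.D) i 0).eval (algebraMap ℝ ℂ) s) reAtTop (𝓝 0) := by
    intro i
    have h1 := tendsto_pi_nhds.1 (tendsto_pi_nhds.1 (hlim.congr' (EventuallyEq.symm hmul)) i) 0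
    exact h1
  choose c Q hQ hcQ using fun i => exists_mul_eval_eq (hr i)
  refine ⟨c, Q, hQ, ?_⟩
  filter_upwards [eventually_all.2 hcQ, hmul] with s h1 h2 i
  rw [← h1 i, ← h2]
  rfl

namespace ILCSystem.FrequencyEquation

variable {q p m : ℕ} {S : ILCSystem q p m} {u u' : ℝ → Fin p → ℝ} {y y' : ℝ → Fin q → ℝ}

theorem eventually_eq (h : S.FrequencyEquation u y) :
    ∀ᶠ s in reAtTop, ratEval S.G₁ s *ᵥ laplaceTransform u s =
      laplaceTransform y s - (ratEval S.G₂ s * ratEval S.D s).col 0 :=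
  eventually_reAtTop.2 h.2.2

/-- The output starts at the initial value `c` of the response to the additional input, since the
response to `u` starts at `0`. -/
theorem eq_initial {T : ℝ} (hT : 0 < T) (h : S.FrequencyEquation u y)
    (hy : ContinuousOn y (Set.Icc 0 T)) {M : Matrix (Fin q) (Fin p) ℝ}
    (hM : Tendsto (fun s : ℂ => s • ratEval S.G₁ s) reAtTop (𝓝 (M.map (fun x : ℝ => (x : ℂ)))))
    {c : Fin q → ℝ} {Q : Fin q → ℂ → ℂ} (hQ : ∀ i, IsRealTransform (Q i))
    (hc : ∀ᶠ s in reAtTop, ∀ i, s * (ratEval S.G₂ s * ratEval S.D s).col 0 i = c i + Q i s) :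
    y 0 = c := by
  ext i
  have hY : Tendsto (fun x : ℝ => (x : ℂ) * laplaceTransform y x i) atTop (𝓝 (y 0 i)) := by
    refine (hasTransform_laplaceTransform h.2.1 i).tendsto_mul (Tendsto.mono_left ?_ inf_le_left)
    have h1 : Tendsto y (𝓝[>] 0) (𝓝 (y 0)) := by
      have := hy 0 (by simp [hT.le])
      refine this.mono_left ?_
      rw [← nhdsWithin_Ioo_eq_nhdsGT hT]
      exact nhdsWithin_mono _ Set.Ioo_subset_Icc_self
    exact (Complex.continuous_ofReal.tendsto _).comp (tendsto_pi_nhds.1 h1 i)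
  have hU : Tendsto (fun x : ℝ => laplaceTransform u x) atTop (𝓝 0) :=
    tendsto_pi_nhds.2 fun j => (hasTransform_laplaceTransform h.1 j).tendsto_zero
  have hGU : Tendsto (fun x : ℝ => ((x : ℂ) • ratEval S.G₁ x) *ᵥ laplaceTransform u x) atTop
      (𝓝 0) := by
    have := ((Continuous.matrix_mulVec continuous_fst continuous_snd).tendsto _).comp
      ((hM.comp tendsto_ofReal_reAtTop).prodMk_nhds hU)
    simpa [Function.comp_def] using! this
  obtain ⟨f, hf⟩ := hQ i
  have hlim : Tendsto (fun x : ℝ => (((x : ℂ) • ratEval S.G₁ x) *ᵥ laplaceTransform u x) i +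
      (c i + Q i x)) atTop (𝓝 (c i)) := by
    simpa using! (tendsto_pi_nhds.1 hGU i).add (hf.tendsto_zero.const_add (c i : ℂ))
  have := tendsto_nhds_unique (hY.congr' ?_) hlim
  · exact_mod_cast this
  filter_upwards [tendsto_ofReal_reAtTop.eventually h.eventually_eq,
    tendsto_ofReal_reAtTop.eventually hc] with x h1 h2
  rw [← h2 i, Matrix.smul_mulVec, h1]
  simp only [Pi.smul_apply, Pi.sub_apply, smul_eq_mul]
  ring

/-- If the leading coefficient `M` of `G₁` has a left inverse `L`, the output on `[0, T]` determines
the input on `[0, T]`. With `(1 + B)⁻¹ = s L G₁`, the differences `W` of the inputs and `Z` of the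
outputs satisfy `W / s = (1 + B) L Z`, and the signal on the right vanishes on `[0, T]`. -/
theorem ae_eq_of_eqOn {T : ℝ} (h : S.FrequencyEquation u y) (h' : S.FrequencyEquation u' y')
    (hy : Set.EqOn y y' (Set.Icc 0 T)) {M : Matrix (Fin q) (Fin p) ℝ}
    (hM : Tendsto (fun s : ℂ => s • ratEval S.G₁ s) reAtTop (𝓝 (M.map (fun x : ℝ => (x : ℂ)))))
    {L : Matrix (Fin p) (Fin q) ℝ} (hL : L * M = 1) :
    u =ᵐ[volume.restrict (Set.Icc 0 T)] u' := by
  obtain ⟨B, hB, hBinv⟩ := exists_transform_left_inverse hM hL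
  choose k hk using hB
  set Lc := L.map (fun x : ℝ => (x : ℂ)) with hLc
  set W : ℂ → Fin p → ℂ := fun s => laplaceTransform u s - laplaceTransform u' s with hW
  set Z : ℂ → Fin q → ℂ := fun s => laplaceTransform y s - laplaceTransform y' s with hZ
  have hGW : ∀ᶠ s in reAtTop, ratEval S.G₁ s *ᵥ W s = Z s := by
    filter_upwards [h.eventually_eq, h'.eventually_eq] with s h1 h2
    rw [hW, hZ, Matrix.mulVec_sub, h1, h2]; simp
  have hWZ : ∀ᶠ s in reAtTop, W s = s • ((1 + B s) *ᵥ (Lc *ᵥ Z s)) := by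
    filter_upwards [hBinv, hGW] with s h1 h2
    rw [Matrix.mul_smul, ← Matrix.mul_assoc] at h1
    rw [← h2, Matrix.mulVec_mulVec, Matrix.mulVec_mulVec, ← Matrix.smul_mulVec, h1,
      Matrix.one_mulVec]
  have hz : ∀ i, HasTransform (fun t => ∑ l, ((L i l : ℝ) : ℂ) * ((y t l : ℂ) - (y' t l : ℂ)))
      (fun s => (Lc *ᵥ Z s) i) := fun i => HasTransform.sum _ fun l _ =>
    ((hasTransform_laplaceTransform h.2.1 l).sub
      (hasTransform_laplaceTransform h'.2.1 l)).const_mul _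
  have hz0 : ∀ i, ∀ t ∈ Set.Icc 0 T,
      ∑ l, ((L i l : ℝ) : ℂ) * ((y t l : ℂ) - (y' t l : ℂ)) = 0 := by
    intro i t ht
    simp [hy ht]
  have hb : ∀ j, HasTransform
      (fun t => ∑ l, ((L j l : ℝ) : ℂ) * ((y t l : ℂ) - (y' t l : ℂ)) +
        ∑ i, ∫ r in (0 : ℝ)..t, (k j i r : ℂ) *
          ∑ l, ((L i l : ℝ) : ℂ) * ((y (t - r) l : ℂ) - (y' (t - r) l : ℂ)))
      (fun s => W s j / s) := by
    intro j
    refine ((hz j).add (HasTransform.sum _ fun i _ => (hk j i).mul (hz i))).congr ?_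
    filter_upwards [hWZ, eventually_ne_reAtTop 0] with s h1 h0
    rw [h1, Pi.smul_apply, smul_eq_mul, mul_div_cancel_left₀ _ h0, Matrix.add_mulVec,
      Matrix.one_mulVec]
    rfl
  -- for `t` in `(0, T)` the convolution only sees the output difference on `[0, t]`, where it is `0`
  have hw : ∀ j, ∀ᵐ t : ℝ, t ∈ Set.Ioo 0 T → (u t j : ℂ) - (u' t j : ℂ) = 0 := by
    intro j
    refine ((hasTransform_laplaceTransform h.1 j).sub
      (hasTransform_laplaceTransform h'.1 j)).ae_eq_zero_of_div (hb j) ?_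
    refine Eventually.of_forall fun t ht => ?_
    rw [hz0 j t (Set.Ioo_subset_Icc_self ht), zero_add]
    refine Finset.sum_eq_zero fun i _ => ?_
    refine (intervalIntegral.integral_congr (g := fun _ => 0) fun r hr => ?_).trans (by simp)
    rw [Set.uIcc_of_le ht.1.le] at hr
    simp only
    rw [hz0 i (t - r) ⟨by linarith [hr.2], by linarith [hr.1, ht.2]⟩, mul_zero]
  rw [← restrict_Ioo_eq_restrict_Icc, EventuallyEq, ae_restrict_iff' measurableSet_Ioo]
  filter_upwards [ae_all_iff.2 hw] with t ht hT
  ext j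
  have := sub_eq_zero.1 (ht j hT)
  exact_mod_cast this

/-- Adding to the input a signal whose transform lies in the kernel of `G₁` does not change the
output. -/
theorem add_input {v : ℝ → Fin p → ℝ} {V : ℂ → Fin p → ℂ} (h : S.FrequencyEquation u y)
    (hv : ∀ j, HasTransform (fun t => (v t j : ℂ)) fun s => V s j)
    (hV : ∀ᶠ s in reAtTop, ratEval S.G₁ s *ᵥ V s = 0) :
    S.FrequencyEquation (fun t => u t + v t) y := by
  obtain ⟨h1, h2⟩ := hasLaplaceTransform_of_hasTransform (f := fun t => u t + v t)
    (F := fun j s => laplaceTransform u s j + V s j)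
    fun j => by simpa using! (hasTransform_laplaceTransform h.1 j).add (hv j)
  refine ⟨h1, h.2.1, eventually_reAtTop.1 ?_⟩
  filter_upwards [h2, hV, h.eventually_eq] with s e1 e2 e3
  have : laplaceTransform (fun t => u t + v t) s = laplaceTransform u s + V s := funext e1
  rw [this, Matrix.mulVec_add, e2, add_zero, e3]

end ILCSystem.FrequencyEquation

/-- A continuously differentiable function on `[0, T]` extends to a signal `y` on `[0, ∞)` whose
transform `Y` satisfies `s Y(s) = y(0) + G(s)` for a transform `G`: continue the derivative by `0`
past `T` and integrate. -/
theorem exists_extension {T : ℝ} (hT : 0 < T) {f : ℝ → ℝ} (hf : ContDiffOn ℝ 1 f (Set.Icc 0 T)) :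
    ∃ (g : ℝ → ℝ) (D Y : ℂ → ℂ), Set.EqOn g f (Set.Icc 0 T) ∧ IsRealTransform D ∧
      HasTransform (fun t => (g t : ℂ)) Y ∧ ∀ᶠ s in reAtTop, s * Y s = f 0 + D s := by
  have hud := uniqueDiffOn_Icc hT
  have hcont : ContinuousOn (derivWithin f (Set.Icc 0 T)) (Set.Icc 0 T) :=
    hf.continuousOn_derivWithin hud le_rfl
  set d : ℝ → ℝ := (Set.Icc 0 T).indicator (derivWithin f (Set.Icc 0 T)) with hd
  have hdi : Integrable d :=
    (hcont.integrableOn_compact isCompact_Icc).integrable_indicator measurableSet_Icc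
  have hdt : HasTransform (fun t => (d t : ℂ))
      (fun s => ∫ t in Set.Ioi (0 : ℝ), Complex.exp (-s * t) * d t) := by
    refine eventually_reAtTop.2 ⟨0, fun s hs => ⟨?_, rfl⟩⟩
    refine HasTransform.integrableOn_of_le (σ := 0) hs.le ?_
    simpa using! hdi.ofReal.integrableOn
  refine ⟨fun t => f 0 + ∫ r in (0 : ℝ)..t, d r, _, _, ?_, ⟨d, hdt⟩,
    by simpa [intervalIntegral.integral_ofReal] using
      (HasTransform.one.const_mul (f 0 : ℂ)).add (hdt.mul HasTransform.one), ?_⟩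
  · intro t ht
    have h1 : ∫ r in (0 : ℝ)..t, d r = f t - f 0 := by
      refine intervalIntegral.integral_eq_sub_of_hasDerivAt_of_le ht.1
        (hf.continuousOn.mono (Set.Icc_subset_Icc_right ht.2)) (fun x hx => ?_)
        hdi.intervalIntegrable
      have hx' : x ∈ Set.Ioo 0 T := ⟨hx.1, hx.2.trans_le ht.2⟩
      rw [hd, Set.indicator_of_mem (Set.Ioo_subset_Icc_self hx')]
      have hdx := hf.differentiableOn (by simp) x (Set.Ioo_subset_Icc_self hx')
      exact hdx.hasDerivWithinAt.hasDerivAt (Icc_mem_nhds hx'.1 hx'.2)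
    simp only [h1]; ring
  · filter_upwards [eventually_ne_reAtTop 0] with s hs
    field_simp

/-- If the leading coefficient `M` of `G₁` has a right inverse `R`, every continuously
differentiable trajectory with the initial value `c` is trackable, by the input
`U = R (s G₁ R)⁻¹ s (Y - G₂ D)`. The initial condition makes `s (Y - G₂ D)` a transform. -/
theorem ILCSystem.trackable_of_right_inverse {q p m : ℕ} {S : ILCSystem q p m} {T : ℝ}
    (hT : 0 < T) {M : Matrix (Fin q) (Fin p) ℝ}
    (hM : Tendsto (fun s : ℂ => s • ratEval S.G₁ s) reAtTop (𝓝 (M.map (fun x : ℝ => (x : ℂ)))))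
    {R : Matrix (Fin p) (Fin q) ℝ} (hR : M * R = 1)
    {c : Fin q → ℝ} {Q : Fin q → ℂ → ℂ} (hQ : ∀ i, IsRealTransform (Q i))
    (hc : ∀ᶠ s in reAtTop, ∀ i, s * (ratEval S.G₂ s * ratEval S.D s).col 0 i = c i + Q i s)
    {yd : ℝ → Fin q → ℝ} (hyd : ContDiffOn ℝ 1 yd (Set.Icc 0 T)) (h0 : yd 0 = c) :
    S.Trackable T yd := by
  obtain ⟨B, hB, hBinv⟩ := exists_transform_right_inverse hM hR
  choose g D Y hg hD hY hsY using fun i => exists_extension hT (contDiffOn_pi.1 hyd i)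
  set Rc := R.map (fun x : ℝ => (x : ℂ)) with hRc
  set P : ℂ → Fin q → ℂ := fun s i => D i s - Q i s with hP
  set U : ℂ → Fin p → ℂ := fun s => Rc *ᵥ ((1 + B s) *ᵥ P s) with hU
  have hUt : ∀ j, IsRealTransform fun s => U s j := by
    intro j
    have : (fun s => U s j) = fun s => ∑ i, ((R j i : ℝ) : ℂ) * (P s i + ∑ k, B s i k * P s k) := by
      ext s
      simp only [hU, Matrix.add_mulVec, Matrix.one_mulVec]
      rfl
    rw [this]
    exact IsRealTransform.sum _ fun i _ => IsRealTransform.const_mul _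
      (((hD i).sub (hQ i)).add
        (IsRealTransform.sum _ fun k _ => (hB i k).mul ((hD k).sub (hQ k))))
  choose u hu using hUt
  obtain ⟨hu1, hu2⟩ := hasLaplaceTransform_of_hasTransform (f := fun t j => u j t) hu
  obtain ⟨hy1, hy2⟩ := hasLaplaceTransform_of_hasTransform (f := fun t i => g i t) hY
  refine ⟨fun t j => u j t, fun t j => u j t, fun t i => g i t, fun _ _ => rfl,
    fun t ht => funext fun i => hg i ht, hu1, hy1, eventually_reAtTop.1 ?_⟩
  filter_upwards [hu2, hy2, hBinv, hc, eventually_all.2 hsY, eventually_ne_reAtTop 0]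
    with s e1 e2 e3 e4 e5 hs
  have hUs : laplaceTransform (fun t j => u j t) s = U s := funext e1
  have hGU : s • (ratEval S.G₁ s *ᵥ U s) = P s := by
    rw [hU, ← Matrix.smul_mulVec, Matrix.mulVec_mulVec, Matrix.mulVec_mulVec, Matrix.smul_mul, e3,
      Matrix.one_mulVec]
  refine smul_right_injective _ hs ?_
  ext i
  rw [hUs]
  change (s • (ratEval S.G₁ s *ᵥ U s)) i = s * (laplaceTransform (fun t i => g i t) s i - _)
  rw [hGU, mul_sub, e2, e4, e5, h0, hP]
  ring

theorem Matrix.exists_right_inverse_of_rank {q p : ℕ} {M : Matrix (Fin q) (Fin p) ℝ}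
    (h : M.rank = q) : ∃ R : Matrix (Fin p) (Fin q) ℝ, M * R = 1 := by
  rw [← Matrix.mulVec_surjective_iff_exists_right_inverse]
  have : LinearMap.range M.mulVecLin = ⊤ := by
    apply Submodule.eq_top_of_finrank_eq
    rw [← Matrix.rank, h]; simp
  exact LinearMap.range_eq_top.1 this

/-! ### Realizability and trackability -/

theorem corollary1 {q p m : ℕ} (T : ℝ) (hT : 0 < T) (S : ILCSystem q p m)
    (hC1 : S.C1) (hC2 : S.C2) (hC3 : S.C3)
    -- the inputs and the (continuous) outputs of the system along the iterations `k`
    (u : ℕ → ℝ → Fin p → ℝ) (y : ℕ → ℝ → Fin q → ℝ)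
    (hsys : ∀ k, S.Generates T (u k) (y k))
    (hcont : ∀ k, ContinuousOn (y k) (Set.Icc 0 T))
    -- the specified trajectory, with the initial condition
    (yd : ℝ → Fin q → ℝ) (hyd : ContDiffOn ℝ 1 yd (Set.Icc 0 T))
    (hinit : ∀ k, yd 0 = y k 0) :
    (p ≤ q → (S.Realizable T yd ↔ S.Trackable T yd)) ∧
    (q < p → S.Trackable T yd ∧ ¬ S.Realizable T yd) := by
  obtain ⟨M, hM', hrank⟩ := hC3
  have hM : Tendsto (fun s : ℂ => s • ratEval S.G₁ s) reAtTop
      (𝓝 (M.map (fun x : ℝ => (x : ℂ)))) := by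
    simpa using hM'.mono_left reAtTop_le_cobounded
  refine ⟨fun hpq => ⟨fun ⟨ud, h, _⟩ => ⟨ud, h⟩, fun ⟨ud, h⟩ => ⟨ud, h, fun v hv => ?_⟩⟩,
    fun hqp => ?_⟩
  · obtain ⟨Lt, hLt⟩ := Matrix.exists_right_inverse_of_rank (M := Mᵀ) (by
      rw [Matrix.rank_transpose, hrank, min_eq_right hpq])
    have hL : Ltᵀ * M = 1 := by
      have := congrArg Matrix.transpose hLt
      rwa [Matrix.transpose_mul, Matrix.transpose_transpose, Matrix.transpose_one] at this
    obtain ⟨u1, y1, hu1, hy1, h1⟩ := h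
    obtain ⟨u2, y2, hu2, hy2, h2⟩ := hv
    have := h2.ae_eq_of_eqOn h1 (hy2.trans hy1.symm) hM hL
    filter_upwards [this, ae_restrict_mem measurableSet_Icc] with t ht htT
    rw [← hu1 htT, ← hu2 htT, ht]
  · obtain ⟨R, hR⟩ := Matrix.exists_right_inverse_of_rank (M := M) (by
      rw [hrank, min_eq_left hqp.le])
    obtain ⟨c, Q, hQ, hc⟩ := S.exists_free_response hC1 hC2
    have h0 : yd 0 = c := by
      obtain ⟨u0, y0, -, hy0, h0⟩ := hsys 0
      rw [hinit 0, ← hy0 (by simp [hT.le])]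
      exact h0.eq_initial hT ((hcont 0).congr hy0) hM hQ hc
    refine ⟨S.trackable_of_right_inverse hT hM hR hQ hc hyd h0, ?_⟩
    rintro ⟨ud, ⟨u1, y1, hu1, hy1, h1⟩, huniq⟩
    obtain ⟨n, hn, hn0⟩ : ∃ n, M *ᵥ n = 0 ∧ n ≠ 0 := by
      have := LinearMap.ker_ne_bot_of_finrank_lt (f := M.mulVecLin) (by simpa using hqp)
      obtain ⟨n, hn, hn0⟩ := Submodule.exists_mem_ne_zero_of_ne_bot this
      exact ⟨n, by simpa using hn, hn0⟩
    obtain ⟨V, hV, hVker, hVlim⟩ := exists_transform_mem_ker hM hR hn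
    choose v hv using hV
    have h2 := h1.add_input (v := fun t j => v j t) hv hVker
    have hae := huniq _ ⟨_, y1, fun _ _ => rfl, hy1, h2⟩
    refine hn0 (funext fun j => ?_)
    -- the added signal vanishes near `0`, hence so does its initial value
    have hv0 : Tendsto (fun t => (v j t : ℂ)) (𝓝[>] 0 ⊓ ae volume) (𝓝 0) := by
      have hT' : ∀ᶠ t : ℝ in 𝓝[>] 0 ⊓ ae volume, t ∈ Set.Icc 0 T :=
        Eventually.filter_mono inf_le_left
          (mem_of_superset (Ioo_mem_nhdsGT hT) Set.Ioo_subset_Icc_self)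
      have hae' := (ae_restrict_iff' measurableSet_Icc).1 hae
      refine tendsto_const_nhds.congr' ?_
      filter_upwards [hT', hae'.filter_mono inf_le_right] with t ht h3
      have := congrFun (h3 ht) j
      rw [← hu1 ht] at this
      have h4 : v j t = 0 := by simpa using this
      simp [h4]
    exact_mod_cast tendsto_nhds_unique (hVlim j) ((hv j).tendsto_mul hv0)
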